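/- Let $\mathbf u = u_0u_1u_2\cdots$ be a Sturmian sequence over $\{0,1\}$, i.e. a sequence having exactly $m+1$ distinct factors (finite blocks of consecutive letters) of length $m$ for every $m \ge 0$, and let $n \ge 1$ be an integer. A factor $w$ of $\mathbf u$ is bispecial if $0w, 1w, w0, w1$ are all factors of $\mathbf u$. A palindrome $p$ has center $\varepsilon$ (the empty word) if its length is even, and has center $a \in \{0,1\}$ if its length is odd and $a$ is its middle letter. In a set of words, the shortest word means the element that is strictly shorter than all the other elements. For each $c \in \{\varepsilon, 0, 1\}$ the set of bispecial factors of $\mathbf u$ that have length at least $n$ and are palindromes with center $c$ has a shortest element $P_c$, and the following statements hold. 1. For every factor $w$ of $\mathbf u$ of length $n$ there is a shortest bispecial factor $v$ of $\mathbf u$ containing $w$, and $v \in \{P_\varepsilon, P_0, P_1\}$. 2. If $\mathbf u$ has no bispecial factor of length $n-1$, then for each $i \in \{\varepsilon, 0, 1\}$ there is a factor $w$ of $\mathbf u$ of length $n$ such that $P_i$ is the shortest bispecial factor containing $w$. 3. If $v$ is a bispecial factor of $\mathbf u$ of length $n-1$, then $v$ is a palindrome; let $i \in \{\varepsilon, 0,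 1\}$ be its center. For each $j \in \{\varepsilon, 0, 1\}$ with $j \ne i$ there is a factor $w$ of $\mathbf u$ of length $n$ such that $P_j$ is the shortest bispecial factor containing $w$, while there is no factor $w$ of $\mathbf u$ of length $n$ such that $P_i$ is the shortest bispecial factor containing $w$. -/

import Mathlib

/-- `w` is a factor of the sequence `u`: `w = u_i u_{i+1} ⋯ u_{i+m-1}` for some `i` and `m`
(the empty word being a factor, with `m = 0`). -/
def IsFactor {α : Type*} (u : ℕ → α) (w : List α) : Prop :=
  ∃ i m : ℕ, w = (List.range m).map (fun k => u (i + k))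

/-- The factor complexity of `u`: the number of factors of `u` of length `n`. -/
noncomputable def factorComplexity {α : Type*} (u : ℕ → α) (n : ℕ) : ℕ :=
  {w : List α | IsFactor u w ∧ w.length = n}.ncard

/-- A binary sequence is Sturmian if it has exactly `n + 1` factors of length `n`, for every
`n ≥ 0`. -/
def IsSturmian (u : ℕ → Fin 2) : Prop :=
  ∀ n : ℕ, factorComplexity u n = n + 1

/-- A factor `w` is right special if `wa` and `wb` are factors for two distinct letters. -/
def IsRightSpecial {α : Type*} (u : ℕ → α) (w : List α) : Prop :=
  IsFactor u w ∧ ∃ a b : α, a ≠ b ∧ IsFactor u (w ++ [a]) ∧ IsFactor u (w ++ [b])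

/-- A factor `w` is left special if `aw` and `bw` are factors for two distinct letters. -/
def IsLeftSpecial {α : Type*} (u : ℕ → α) (w : List α) : Prop :=
  IsFactor u w ∧ ∃ a b : α, a ≠ b ∧ IsFactor u (a :: w) ∧ IsFactor u (b :: w)

/-- A factor is bispecial if it is both left and right special. -/
def IsBispecial {α : Type*} (u : ℕ → α) (w : List α) : Prop :=
  IsLeftSpecial u w ∧ IsRightSpecial u w

/-- `p` is a palindrome with center `c`. The center is the empty word (`none`), when
`p` is `s` followed by its reversal, or a letter `a` (`some a`), when `p` is `s`, then `a`, then
the reversal of `s`. -/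
def HasCenter {α : Type*} (p : List α) (c : Option α) : Prop :=
  ∃ s : List α, p = s ++ c.toList ++ s.reverse

/-- `v` is the shortest word in the set `S`: it lies in `S` and every other word in `S` is
strictly longer (so there is at most one such `v`). -/
def IsTheShortest {α : Type*} (S : Set (List α)) (v : List α) : Prop :=
  v ∈ S ∧ ∀ v' ∈ S, v' ≠ v → v.length < v'.length

/-- `v` is the shortest bispecial factor of `u` that contains the word `w` as a factor. -/
def IsShortestBispecialContaining {α : Type*} (u : ℕ → α) (w v : List α) : Prop :=
  IsTheShortest {b : List α | IsBispecial u b ∧ w <:+: b} v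

/-- `v` is the shortest bispecial factor of `u` of length at least `n` with center `c`. -/
def IsShortestBispecialWithCenter {α : Type*} (u : ℕ → α) (n : ℕ) (c : Option α)
    (v : List α) : Prop :=
  IsTheShortest {b : List α | IsBispecial u b ∧ n ≤ b.length ∧ HasCenter b c} v

/-!
Write `B(w)` for the set of bispecial factors containing a factor `w`. If `w` is not right special,
the letter `a` after it is forced and `B(w a) = B(w)`; likewise on the left. Hence `v` is the
shortest bispecial factor containing `w` as soon as `v` is bispecial and `B(w) = B(v)`, and it
suffices to compare the sets `B(w)`.

*Upper bound.* Sturmian sequences have exactly one left special factor `l` and one right special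
factor `r` of each length. For length `n - 1`, sliding a block of length `n` to the right shows that
every `B(w)` with `|w| = n` is `B(0 l)`, `B(1 l)` or `B(d r)` with `d r` a factor
(`IsSturmian.bispecialsContaining_eq_cons_special`). These are three sets if `l ≠ r`, since then
`d` is determined, and only two if `l = r` is bispecial.

*Lower bound.* The set of factors is closed under reversal (`IsSturmian.isFactor_reverse`), so
bispecial factors are palindromes, a palindrome is bispecial once it is left or right special, and
each palindromic factor `p` has exactly one palindromic prolongation `a p a`. The palindromic
factors with a given center thus form one infinite chain, along which a palindrome that is not
bispecial has the same `B` as the next one. Starting from the palindrome of length `n - 1` or `n`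
with center `j`, one reaches `P_j`, so `B(P_j)` is `B(w)` for some `w` of length `n`, unless the
starting palindrome is the bispecial factor of length `n - 1`
(`IsSturmian.exists_bispecialsContaining_eq`).

The sets `B(P_j)` are distinct, so the two bounds match, and all sets `B(w)` are accounted for.
-/

/-! ### Factors as blocks at a position -/

/-- The block `u_i u_{i+1} ⋯ u_{i+m-1}` of length `m` at position `i`. -/
def window {α : Type*} (u : ℕ → α) (i m : ℕ) : List α :=
  (List.range m).map fun k => u (i + k)

section Window

variable {α : Type*} {u : ℕ → α}

@[simp] lemma length_window (u : ℕ → α) (i m : ℕ) : (window u i m).length = m := by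
  simp [window]

lemma window_succ (u : ℕ → α) (i m : ℕ) :
    window u i (m + 1) = window u i m ++ [u (i + m)] := by
  simp [window, List.range_succ]

lemma window_succ' (u : ℕ → α) (i m : ℕ) :
    window u i (m + 1) = u i :: window u (i + 1) m := by
  simp [window, List.range_succ_eq_map, Function.comp_def, Nat.add_comm, Nat.add_left_comm]

lemma window_add (u : ℕ → α) (i m k : ℕ) :
    window u i (m + k) = window u i m ++ window u (i + m) k := by
  induction k with
  | zero => simp [window]
  | succ k ih => rw [← Nat.add_assoc, window_succ, ih, window_succ, List.append_assoc, Nat.add_assoc]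

lemma getElem_window (u : ℕ → α) (i m k : ℕ) (h : k < (window u i m).length) :
    (window u i m)[k] = u (i + k) := by
  simp [window]

lemma isFactor_window (u : ℕ → α) (i m : ℕ) : IsFactor u (window u i m) :=
  ⟨i, m, rfl⟩

lemma IsFactor.exists_window {w : List α} (h : IsFactor u w) :
    ∃ i, w = window u i w.length := by
  obtain ⟨i, m, rfl⟩ := h
  exact ⟨i, by simp [window]⟩

lemma IsFactor.of_infix {v w : List α} (h : IsFactor u w) (hv : v <:+: w) : IsFactor u v := by
  obtain ⟨s, t, rfl⟩ := hv
  obtain ⟨i, hi⟩ := h.exists_window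
  simp only [List.length_append, window_add] at hi
  have h1 := (List.append_inj hi (by simp)).1
  have h2 := (List.append_inj h1 (by simp)).2
  rw [h2]
  exact isFactor_window _ _ _

lemma IsFactor.exists_append {w : List α} (h : IsFactor u w) : ∃ a, IsFactor u (w ++ [a]) := by
  obtain ⟨i, hi⟩ := h.exists_window
  refine ⟨u (i + w.length), ?_⟩
  conv => enter [2, 1]; rw [hi]
  rw [← window_succ]
  exact isFactor_window _ _ _

lemma IsRightSpecial.of_suffix {v w : List α} (h : IsRightSpecial u w) (hv : v <:+ w) :
    IsRightSpecial u v := by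
  obtain ⟨s, rfl⟩ := hv
  obtain ⟨h0, a, b, hab, ha, hb⟩ := h
  exact ⟨h0.of_infix ⟨s, [], by simp⟩, a, b, hab,
    ha.of_infix ⟨s, [], by simp⟩, hb.of_infix ⟨s, [], by simp⟩⟩

lemma IsLeftSpecial.of_prefix {v w : List α} (h : IsLeftSpecial u w) (hv : v <+: w) :
    IsLeftSpecial u v := by
  obtain ⟨s, rfl⟩ := hv
  obtain ⟨h0, a, b, hab, ha, hb⟩ := h
  exact ⟨h0.of_infix ⟨[], s, by simp⟩, a, b, hab,
    ha.of_infix ⟨[], s, by simp⟩, hb.of_infix ⟨[], s, by simp⟩⟩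

lemma eq_of_not_isRightSpecial {w : List α} (h : ¬ IsRightSpecial u w) {a b : α}
    (ha : IsFactor u (w ++ [a])) (hb : IsFactor u (w ++ [b])) : a = b := by
  by_contra hab
  exact h ⟨ha.of_infix ⟨[], [a], by simp⟩, a, b, hab, ha, hb⟩

lemma eq_of_not_isLeftSpecial {w : List α} (h : ¬ IsLeftSpecial u w) {a b : α}
    (ha : IsFactor u (a :: w)) (hb : IsFactor u (b :: w)) : a = b := by
  by_contra hab
  exact h ⟨ha.of_infix ⟨[a], [], by simp⟩, a, b, hab, ha, hb⟩

end Window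

/-! ### Eventual periodicity and recurrence -/

/-- From some index on, `u` is periodic. -/
def EventuallyPeriodic {α : Type*} (u : ℕ → α) : Prop :=
  ∃ k p : ℕ, 0 < p ∧ ∀ t, u (k + t + p) = u (k + t)

/-- A block that is not right special determines the letter after it, so a repeated block forces
periodicity unless a right special block of the same length occurs in between. -/
lemma eventuallyPeriodic_of_window_eq {α : Type*} {u : ℕ → α} {m k l : ℕ} (hkl : k < l)
    (h : window u k m = window u l m)
    (hns : ∀ j, k ≤ j → j < l → ¬ IsRightSpecial u (window u j m)) : EventuallyPeriodic u := by
  obtain ⟨p, rfl⟩ := Nat.exists_eq_add_of_lt hkl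
  have key : ∀ t, window u (k + t) m = window u (k + t + (p + 1)) m ∧
      ¬ IsRightSpecial u (window u (k + t) m) := by
    intro t
    induction t using Nat.strong_induction_on with
    | _ t ih =>
      constructor
      · rcases t with _ | t
        · simpa [Nat.add_assoc] using h
        · obtain ⟨h1, h2⟩ := ih t (by omega)
          have hl : u (k + t + m) = u (k + t + (p + 1) + m) := by
            apply eq_of_not_isRightSpecial h2
            · rw [← window_succ]; exact isFactor_window _ _ _
            · rw [h1, ← window_succ]; exact isFactor_window _ _ _
          have h3 : window u (k + t) (m + 1) = window u (k + t + (p + 1)) (m + 1) := by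
            rw [window_succ, window_succ, h1, hl]
          rw [window_succ', window_succ'] at h3
          have := (List.cons.inj h3).2
          rw [show k + (t + 1) = k + t + 1 by omega,
            show k + t + 1 + (p + 1) = k + t + (p + 1) + 1 by omega]
          exact this
      · by_cases ht : t ≤ p
        · exact hns _ (by omega) (by omega)
        · obtain ⟨h1, h2⟩ := ih (t - (p + 1)) (by omega)
          rw [h1] at h2
          rwa [show k + (t - (p + 1)) + (p + 1) = k + t by omega] at h2
  refine ⟨k + m, p + 1, by omega, fun t => ?_⟩
  obtain ⟨h1, h2⟩ := key t
  have := eq_of_not_isRightSpecial h2 (a := u (k + t + m)) (b := u (k + t + (p + 1) + m))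
    (by rw [← window_succ]; exact isFactor_window _ _ _)
    (by rw [h1, ← window_succ]; exact isFactor_window _ _ _)
  rw [show k + m + t + (p + 1) = k + t + (p + 1) + m by omega,
    show k + m + t = k + t + m by omega]
  exact this.symm

/-- The factors of length `m`. -/
def factorsOfLength {α : Type*} (u : ℕ → α) (m : ℕ) : Set (List α) :=
  {w | IsFactor u w ∧ w.length = m}

lemma finite_factorsOfLength {α : Type*} [Finite α] (u : ℕ → α) (m : ℕ) :
    (factorsOfLength u m).Finite :=
  (List.finite_length_eq α m).subset fun _ h => h.2

lemma window_mem_factorsOfLength {α : Type*} (u : ℕ → α) (i m : ℕ) :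
    window u i m ∈ factorsOfLength u m :=
  ⟨isFactor_window u i m, length_window u i m⟩

lemma exists_isRightSpecial_of_not_eventuallyPeriodic {α : Type*} [Finite α] {u : ℕ → α}
    (h : ¬ EventuallyPeriodic u) (m : ℕ) : ∃ w, IsRightSpecial u w ∧ w.length = m := by
  by_contra! hno
  have hfin : Finite (factorsOfLength u m) := (finite_factorsOfLength u m).to_subtype
  obtain ⟨k, l, hkl, he⟩ := Finite.exists_ne_map_eq_of_infinite
    (fun i : ℕ => (⟨window u i m, window_mem_factorsOfLength u i m⟩ : factorsOfLength u m))
  have he' : window u k m = window u l m := congrArg Subtype.val he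
  have hns : ∀ j, ¬ IsRightSpecial u (window u j m) := fun j hj => hno _ hj (by simp)
  rcases lt_or_gt_of_ne hkl with hlt | hlt
  · exact h (eventuallyPeriodic_of_window_eq hlt he' fun j _ _ => hns j)
  · exact h (eventuallyPeriodic_of_window_eq hlt he'.symm fun j _ _ => hns j)

lemma surjOn_dropLast {α : Type*} (u : ℕ → α) (m : ℕ) :
    Set.SurjOn List.dropLast (factorsOfLength u (m + 1)) (factorsOfLength u m) := by
  rintro w ⟨hw, hl⟩
  obtain ⟨a, ha⟩ := hw.exists_append
  exact ⟨w ++ [a], ⟨ha, by simp [hl]⟩, by simp⟩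

/-- The Morse–Hedlund bound: right special factors of every length make the complexity strictly
increasing. -/
lemma lt_factorComplexity {α : Type*} [Finite α] {u : ℕ → α} (h : ¬ EventuallyPeriodic u)
    (m : ℕ) : m < factorComplexity u m := by
  induction m with
  | zero =>
    exact (Set.ncard_pos (finite_factorsOfLength u 0)).2 ⟨_, window_mem_factorsOfLength u 0 0⟩
  | succ m ih =>
    obtain ⟨w, ⟨_, a, b, hab, ha, hb⟩, hl⟩ := exists_isRightSpecial_of_not_eventuallyPeriodic h m
    by_contra hle
    have := Set.inj_on_of_surj_on_of_ncard_le (s := factorsOfLength u (m + 1))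
      (t := factorsOfLength u m) (fun x _ => x.dropLast)
      (fun x hx => ⟨hx.1.of_infix (List.dropLast_prefix x).isInfix, by simp [hx.2]⟩)
      (fun x hx => by simpa using surjOn_dropLast u m hx)
      (by change factorComplexity u (m + 1) ≤ factorComplexity u m; omega)
      (a₁ := w ++ [a]) ⟨ha, by simp [hl]⟩ (a₂ := w ++ [b]) ⟨hb, by simp [hl]⟩ (by simp)
      (finite_factorsOfLength u (m + 1))
    simp [hab] at this

section Sturmian

variable {u : ℕ → Fin 2}

lemma IsSturmian.not_eventuallyPeriodic (hu : IsSturmian u) : ¬ EventuallyPeriodic u := by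
  rintro ⟨k, p, hp, h⟩
  have hmul : ∀ q t, u (k + t + q * p) = u (k + t) := by
    intro q
    induction q with
    | zero => simp
    | succ q ih =>
      intro t
      rw [← ih t, show k + t + (q + 1) * p = k + (t + q * p) + p by ring, h, Nat.add_assoc]
  have hsub : factorsOfLength u (k + p) ⊆
      ((Finset.range (k + p)).image fun i => window u i (k + p) : Finset (List (Fin 2))) := by
    rintro w ⟨hw, hl⟩
    obtain ⟨i, hi⟩ := hw.exists_window
    rw [hl] at hi
    simp only [Finset.coe_image, Finset.coe_range, Set.mem_image, Set.mem_Iio]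
    by_cases hik : i < k
    · exact ⟨i, by omega, hi.symm⟩
    · refine ⟨k + (i - k) % p, by have := Nat.mod_lt (i - k) hp; omega, ?_⟩
      rw [hi]
      refine List.map_congr_left fun t _ => ?_
      have := hmul ((i - k) / p) ((i - k) % p + t)
      rw [← Nat.add_assoc] at this
      rw [← this]
      congr 1
      have := Nat.mod_add_div (i - k) p
      rw [Nat.mul_comm] at this
      omega
  have h1 := Set.ncard_le_ncard hsub (Finset.finite_toSet _)
  rw [Set.ncard_coe_finset] at h1
  have h2 := Finset.card_image_le (s := Finset.range (k + p)) (f := fun i => window u i (k + p))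
  have h3 : (factorsOfLength u (k + p)).ncard = k + p + 1 := hu (k + p)
  rw [Finset.card_range] at h2
  omega

/-- Every factor occurs arbitrarily far out: the tails of `u` have as many factors as `u`. -/
lemma IsSturmian.exists_window_ge (hu : IsSturmian u) {w : List (Fin 2)} (hw : IsFactor u w)
    (K : ℕ) : ∃ j, K ≤ j ∧ w = window u j w.length := by
  set v : ℕ → Fin 2 := fun t => u (K + t) with hv
  have hwin : ∀ i m, window v i m = window u (K + i) m := by
    intro i m; simp [window, hv, Nat.add_assoc]
  have hper : ¬ EventuallyPeriodic v := by
    rintro ⟨k, p, hp, h⟩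
    refine hu.not_eventuallyPeriodic ⟨K + k, p, hp, fun t => ?_⟩
    simpa [hv, Nat.add_assoc] using h t
  have hsub : factorsOfLength v w.length ⊆ factorsOfLength u w.length := by
    rintro x ⟨hx, hl⟩
    obtain ⟨i, hi⟩ := hx.exists_window
    rw [hwin] at hi
    exact ⟨hi ▸ isFactor_window _ _ _, hl⟩
  have heq := Set.eq_of_subset_of_ncard_le hsub (by
    have h1 := lt_factorComplexity hper w.length
    have h2 := hu w.length
    change factorComplexity u _ ≤ factorComplexity v _
    omega) (finite_factorsOfLength u _)
  have hm : w ∈ factorsOfLength v w.length := heq ▸ ⟨hw, rfl⟩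
  obtain ⟨i, hi⟩ := hm.1.exists_window
  exact ⟨K + i, by omega, by rw [← hwin]; exact hi⟩

lemma IsSturmian.exists_cons (hu : IsSturmian u) {w : List (Fin 2)} (hw : IsFactor u w) :
    ∃ a, IsFactor u (a :: w) := by
  obtain ⟨j, hj, h⟩ := hu.exists_window_ge hw 1
  obtain ⟨j, rfl⟩ := Nat.exists_eq_add_of_le' hj
  refine ⟨u j, ?_⟩
  conv => enter [2, 2]; rw [h]
  rw [← window_succ']
  exact isFactor_window _ _ _

/-! ### Special factors are unique in their length -/

/-- A surjection of a finite set onto one with one element fewer has at most one nontrivial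
fibre. -/
lemma map_eq_of_surjOn_of_ncard_le_succ {α β : Type*} {S : Set α} {T : Set β} {f : α → β}
    (hS : S.Finite) (hf : Set.SurjOn f S T) (hc : S.ncard ≤ T.ncard + 1) {x y x' y' : α}
    (hx : x ∈ S) (hy : y ∈ S) (hx' : x' ∈ S) (hy' : y' ∈ S) (hxy : x ≠ y) (hxy' : x' ≠ y')
    (he : f x = f y) (he' : f x' = f y') : f x = f x' := by
  by_contra hne
  have hxx : x ≠ x' := fun h => hne (h ▸ rfl)
  have hsub : T ⊆ f '' (S \ {x, x'}) := by
    intro t ht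
    obtain ⟨s, hs, rfl⟩ := hf ht
    by_cases h1 : s = x
    · exact ⟨y, ⟨hy, by simp only [Set.mem_insert_iff, Set.mem_singleton_iff]; grind⟩, by grind⟩
    · by_cases h2 : s = x'
      · exact ⟨y', ⟨hy', by simp only [Set.mem_insert_iff, Set.mem_singleton_iff]; grind⟩,
          by grind⟩
      · exact ⟨s, ⟨hs, by simp [h1, h2]⟩, rfl⟩
  have h1 := Set.ncard_le_ncard hsub ((hS.subset Set.sdiff_subset).image f)
  have h2 := Set.ncard_image_le (f := f) (hS.subset (Set.sdiff_subset (t := {x, x'})))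
  have h3 := Set.ncard_sdiff_add_ncard_of_subset (s := {x, x'}) (t := S)
    (by grind) hS
  rw [Set.ncard_pair hxx] at h3
  omega

lemma IsSturmian.ncard_factorsOfLength (hu : IsSturmian u) (m : ℕ) :
    (factorsOfLength u m).ncard = m + 1 := hu m

lemma IsSturmian.eq_of_isRightSpecial (hu : IsSturmian u) {v w : List (Fin 2)}
    (hv : IsRightSpecial u v) (hw : IsRightSpecial u w) (h : v.length = w.length) : v = w := by
  obtain ⟨_, a, b, hab, ha, hb⟩ := hv
  obtain ⟨_, c, d, hcd, hc, hd⟩ := hw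
  have := map_eq_of_surjOn_of_ncard_le_succ (finite_factorsOfLength u (w.length + 1))
    (surjOn_dropLast u w.length) (by simp [hu.ncard_factorsOfLength])
    (x := v ++ [a]) (y := v ++ [b]) (x' := w ++ [c]) (y' := w ++ [d])
    ⟨ha, by simp [h]⟩ ⟨hb, by simp [h]⟩ ⟨hc, by simp⟩ ⟨hd, by simp⟩
    (by simpa) (by simpa) (by simp) (by simp)
  simpa using this

lemma IsSturmian.surjOn_tail (hu : IsSturmian u) (m : ℕ) :
    Set.SurjOn List.tail (factorsOfLength u (m + 1)) (factorsOfLength u m) := by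
  rintro w ⟨hw, hl⟩
  obtain ⟨a, ha⟩ := hu.exists_cons hw
  exact ⟨a :: w, ⟨ha, by simp [hl]⟩, by simp⟩

lemma IsSturmian.eq_of_isLeftSpecial (hu : IsSturmian u) {v w : List (Fin 2)}
    (hv : IsLeftSpecial u v) (hw : IsLeftSpecial u w) (h : v.length = w.length) : v = w := by
  obtain ⟨_, a, b, hab, ha, hb⟩ := hv
  obtain ⟨_, c, d, hcd, hc, hd⟩ := hw
  have := map_eq_of_surjOn_of_ncard_le_succ (finite_factorsOfLength u (w.length + 1))
    (hu.surjOn_tail w.length) (by simp [hu.ncard_factorsOfLength])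
    (x := a :: v) (y := b :: v) (x' := c :: w) (y' := d :: w)
    ⟨ha, by simp [h]⟩ ⟨hb, by simp [h]⟩ ⟨hc, by simp⟩ ⟨hd, by simp⟩
    (by simpa) (by simpa) (by simp) (by simp)
  simpa using this

lemma IsSturmian.exists_isRightSpecial (hu : IsSturmian u) (m : ℕ) :
    ∃ w, IsRightSpecial u w ∧ w.length = m :=
  exists_isRightSpecial_of_not_eventuallyPeriodic hu.not_eventuallyPeriodic m

lemma IsRightSpecial.isFactor_append {w : List (Fin 2)} (h : IsRightSpecial u w) (c : Fin 2) :
    IsFactor u (w ++ [c]) := by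
  obtain ⟨_, a, b, hab, ha, hb⟩ := h
  obtain rfl | rfl : c = a ∨ c = b := by omega
  exacts [ha, hb]

lemma IsLeftSpecial.isFactor_cons {w : List (Fin 2)} (h : IsLeftSpecial u w) (c : Fin 2) :
    IsFactor u (c :: w) := by
  obtain ⟨_, a, b, hab, ha, hb⟩ := h
  obtain rfl | rfl : c = a ∨ c = b := by omega
  exacts [ha, hb]

end Sturmian

/-! ### Closure under reversal -/

section Reversal

variable {u : ℕ → Fin 2}

/-- The step that needs more than counting. If `a x b` were missing, `a x` would force the letter
`a`, so that `b x` would be the only right special factor of its length; but `b x` cannot occur in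
the `|x| + 2` blocks that follow an occurrence of `a x`, and by pigeonhole two of these agree. -/
lemma IsSturmian.isFactor_cons_append (hu : IsSturmian u) {x : List (Fin 2)}
    (hpal : x.reverse = x) (hx : IsBispecial u x) {a b : Fin 2} (hab : a ≠ b) :
    IsFactor u (a :: x ++ [b]) := by
  by_contra hno
  have forced : ∀ c, IsFactor u (a :: x ++ [c]) → c = a := by
    intro c hc
    have : c ≠ b := fun h => hno (h ▸ hc)
    omega
  have hnotA : ¬ IsRightSpecial u (a :: x) := by
    rintro ⟨_, c, d, hcd, hc, hd⟩
    exact hcd ((forced c hc).trans (forced d hd).symm)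
  -- hence `b :: x` is the only right special factor of its length
  have hspec : ∀ r, IsRightSpecial u r → r.length = x.length + 1 → r = b :: x := by
    rintro (_ | ⟨c, r⟩) hr hl
    · simp at hl
    · obtain rfl : r = x := hu.eq_of_isRightSpecial (hr.of_suffix (List.suffix_cons _ _)) hx.2
        (by simpa using hl)
      have : c ≠ a := fun h => hnotA (h ▸ hr)
      obtain rfl : c = b := by omega
      rfl
  obtain ⟨i, hi⟩ := (hx.1.isFactor_cons a).exists_window
  rw [List.length_cons, window_succ'] at hi
  obtain ⟨hia, hix⟩ := List.cons.inj hi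
  have hend : u (i + 1 + x.length) = a := by
    refine forced _ ?_
    conv => enter [2, 1]; rw [hi]
    rw [List.cons_append, ← window_succ, ← window_succ']
    exact isFactor_window _ _ _
  have hx1 : ∀ t (ht : t < x.length), x[t] = u (i + 1 + t) := by
    intro t ht
    rw [List.getElem_of_eq hix, getElem_window]
  -- an overlap of `b :: x` with the occurrence of `a :: x ++ [a]` would, `x` being a palindrome,
  -- put `a` and `b` at the same place
  have hclaim : ∀ k ≤ x.length + 1, window u (i + k) (x.length + 1) ≠ b :: x := by
    intro k hk h
    rw [window_succ'] at h
    obtain ⟨hb, hkx⟩ := List.cons.inj h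
    rcases k with _ | k
    · exact hab (hia.trans hb)
    rcases Nat.lt_or_ge k x.length with hlt | hge
    · have e1 := hx1 k hlt
      have e2 : x[x.length - 1 - k] = u (i + (k + 1) + 1 + (x.length - 1 - k)) := by
        rw [List.getElem_of_eq hkx.symm, getElem_window]
      have e3 : x[x.length - 1 - k] = x[k] := by
        rw [← List.getElem_reverse (l := x) (i := k) (by simpa), List.getElem_of_eq hpal]
      rw [show i + (k + 1) + 1 + (x.length - 1 - k) = i + 1 + x.length by omega, hend] at e2
      rw [show i + 1 + k = i + (k + 1) by omega, hb] at e1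
      exact hab (e2.symm.trans (e3.trans e1))
    · obtain rfl : k = x.length := by omega
      rw [show i + (x.length + 1) = i + 1 + x.length by omega, hend] at hb
      exact hab hb
  have hmem : ∀ k ∈ ((Finset.range (x.length + 2) : Finset ℕ) : Set ℕ),
      window u (i + k) (x.length + 1) ∈ factorsOfLength u (x.length + 1) \ {b :: x} := by
    intro k hk
    refine ⟨window_mem_factorsOfLength _ _ _, hclaim k ?_⟩
    simp at hk; omega
  have hcard : (factorsOfLength u (x.length + 1) \ {b :: x}).ncard <
      ((Finset.range (x.length + 2) : Finset ℕ) : Set ℕ).ncard := by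
    have := Set.ncard_sdiff_singleton_add_one (s := factorsOfLength u (x.length + 1))
      (a := b :: x) ⟨hx.1.isFactor_cons b, by simp⟩ (finite_factorsOfLength u _)
    rw [hu.ncard_factorsOfLength] at this
    rw [Set.ncard_coe_finset, Finset.card_range]
    omega
  obtain ⟨k, hk, l, hl, hkl, he⟩ := Set.exists_ne_map_eq_of_ncard_lt_of_maps_to hcard hmem
    ((finite_factorsOfLength u _).subset Set.sdiff_subset)
  simp only [Finset.coe_range, Set.mem_Iio] at hk hl
  have hns : ∀ j, i ≤ j → j < i + (x.length + 2) →
      ¬ IsRightSpecial u (window u j (x.length + 1)) := by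
    intro j h1 h2 h
    obtain ⟨j, rfl⟩ := Nat.exists_eq_add_of_le h1
    exact hclaim j (by omega) (hspec _ h (by simp))
  rcases lt_or_gt_of_ne hkl with hlt | hlt
  · exact hu.not_eventuallyPeriodic (eventuallyPeriodic_of_window_eq (by omega) he
      fun j h1 h2 => hns j (by omega) (by omega))
  · exact hu.not_eventuallyPeriodic (eventuallyPeriodic_of_window_eq (by omega) he.symm
      fun j h1 h2 => hns j (by omega) (by omega))

/-- By induction on the length: for `w = a x b`, the factors `a x` and `x b` can be reversed, and
these determine whether `b x.reverse a` is a factor unless `x.reverse` is bispecial; in that case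
`x` is a palindrome and `IsSturmian.isFactor_cons_append` applies. -/
lemma IsSturmian.isFactor_reverse (hu : IsSturmian u) {w : List (Fin 2)} (hw : IsFactor u w) :
    IsFactor u w.reverse := by
  obtain ⟨m, hm⟩ : ∃ m, w.length ≤ m := ⟨_, le_rfl⟩
  induction m generalizing w with
  | zero => simpa [List.length_eq_zero_iff.1 (Nat.le_zero.1 hm)] using hw
  | succ m ih =>
    rcases w with _ | ⟨a, w⟩
    · simpa using hw
    rcases List.eq_nil_or_concat' w with rfl | ⟨x, b, rfl⟩
    · simpa using hw
    simp only [List.length_cons, List.length_append, List.length_nil] at hm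
    have hax : IsFactor u (x.reverse ++ [a]) := by
      simpa using ih (hw.of_infix (v := a :: x) ⟨[], [b], by simp⟩) (by simp; omega)
    have hxb : IsFactor u (b :: x.reverse) := by
      simpa using ih (hw.of_infix (v := x ++ [b]) ⟨[a], [], by simp⟩) (by simp; omega)
    have hgoal : (a :: (x ++ [b])).reverse = b :: x.reverse ++ [a] := by simp
    rw [hgoal]
    by_cases hr : IsRightSpecial u x.reverse
    · by_cases hl : IsLeftSpecial u x.reverse
      · have hxr : IsRightSpecial u x := by
          refine ⟨hw.of_infix ⟨[a], [b], by simp⟩, 0, 1, by simp, ?_, ?_⟩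
          · simpa using ih (hl.isFactor_cons 0) (by simp; omega)
          · simpa using ih (hl.isFactor_cons 1) (by simp; omega)
        have hpal := hu.eq_of_isRightSpecial hr hxr (by simp)
        by_cases hab : b = a
        · subst hab
          rwa [hpal]
        · exact hu.isFactor_cons_append (by rw [hpal, hpal]) ⟨hl, hr⟩ hab
      · obtain ⟨e, he⟩ := hu.exists_cons hax
        obtain rfl : b = e := eq_of_not_isLeftSpecial hl hxb (he.of_infix ⟨[], [a], by simp⟩)
        exact he
    · obtain ⟨e, he⟩ := hxb.exists_append
      obtain rfl : a = e := eq_of_not_isRightSpecial hr hax (he.of_infix ⟨[b], [], by simp⟩)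
      exact he

lemma IsSturmian.isLeftSpecial_reverse (hu : IsSturmian u) {w : List (Fin 2)}
    (h : IsRightSpecial u w) : IsLeftSpecial u w.reverse := by
  obtain ⟨hw, a, b, hab, ha, hb⟩ := h
  exact ⟨hu.isFactor_reverse hw, a, b, hab, by simpa using hu.isFactor_reverse ha,
    by simpa using hu.isFactor_reverse hb⟩

lemma IsSturmian.isRightSpecial_reverse (hu : IsSturmian u) {w : List (Fin 2)}
    (h : IsLeftSpecial u w) : IsRightSpecial u w.reverse := by
  obtain ⟨hw, a, b, hab, ha, hb⟩ := h
  exact ⟨hu.isFactor_reverse hw, a, b, hab, by simpa using hu.isFactor_reverse ha,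
    by simpa using hu.isFactor_reverse hb⟩

lemma IsSturmian.reverse_eq_of_isBispecial (hu : IsSturmian u) {w : List (Fin 2)}
    (h : IsBispecial u w) : w.reverse = w :=
  hu.eq_of_isRightSpecial (hu.isRightSpecial_reverse h.1) h.2 (by simp)

lemma IsSturmian.isBispecial_of_isRightSpecial (hu : IsSturmian u) {p : List (Fin 2)}
    (hpal : p.reverse = p) (h : IsRightSpecial u p) : IsBispecial u p :=
  ⟨by simpa [hpal] using hu.isLeftSpecial_reverse h, h⟩

lemma IsSturmian.isBispecial_of_isLeftSpecial (hu : IsSturmian u) {p : List (Fin 2)}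
    (hpal : p.reverse = p) (h : IsLeftSpecial u p) : IsBispecial u p :=
  ⟨h, by simpa [hpal] using hu.isRightSpecial_reverse h⟩

/-! ### Palindromes and their centers -/

lemma IsSturmian.exists_isFactor_cons_append_self (hu : IsSturmian u) {p : List (Fin 2)}
    (hp : IsFactor u p) (hpal : p.reverse = p) : ∃ a, IsFactor u (a :: p ++ [a]) := by
  by_cases hr : IsRightSpecial u p
  · obtain ⟨_ | ⟨a, r⟩, hr', hl⟩ := hu.exists_isRightSpecial (p.length + 1)
    · simp at hl
    · obtain rfl : r = p := hu.eq_of_isRightSpecial (hr'.of_suffix (List.suffix_cons _ _)) hr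
        (by simpa using hl)
      exact ⟨a, hr'.isFactor_append a⟩
  · obtain ⟨a, ha⟩ := hp.exists_append
    obtain ⟨b, hb⟩ := hu.exists_cons ha
    have hb' : IsFactor u (p ++ [b]) := by
      simpa [hpal] using hu.isFactor_reverse (hb.of_infix (v := b :: p) ⟨[], [a], by simp⟩)
    obtain rfl := eq_of_not_isRightSpecial hr ha hb'
    exact ⟨_, hb⟩

lemma IsSturmian.eq_of_isFactor_cons_append_self (hu : IsSturmian u) {p : List (Fin 2)}
    (hpal : p.reverse = p) {a b : Fin 2} (ha : IsFactor u (a :: p ++ [a]))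
    (hb : IsFactor u (b :: p ++ [b])) : a = b := by
  have ha' : IsFactor u (p ++ [a]) := ha.of_infix ⟨[a], [], by simp⟩
  have hb' : IsFactor u (p ++ [b]) := hb.of_infix ⟨[b], [], by simp⟩
  by_contra hab
  have hbi := hu.isBispecial_of_isRightSpecial hpal
    ⟨ha'.of_infix ⟨[], [a], by simp⟩, a, b, hab, ha', hb'⟩
  -- both `a :: p` and `b :: p` would be right special
  have h1 : IsRightSpecial u (a :: p) := ⟨hbi.1.isFactor_cons a, a, b, hab, ha,
    hu.isFactor_cons_append hpal hbi hab⟩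
  have h2 : IsRightSpecial u (b :: p) := ⟨hbi.1.isFactor_cons b, b, a, Ne.symm hab, hb,
    hu.isFactor_cons_append hpal hbi (Ne.symm hab)⟩
  exact hab (List.cons.inj (hu.eq_of_isRightSpecial h1 h2 (by simp))).1

lemma HasCenter.reverse_eq {α : Type*} {p : List α} {c : Option α} (h : HasCenter p c) :
    p.reverse = p := by
  obtain ⟨s, rfl⟩ := h
  cases c <;> simp

lemma HasCenter.cons_append {α : Type*} {p : List α} {c : Option α} (h : HasCenter p c) (a : α) :
    HasCenter (a :: p ++ [a]) c := by
  obtain ⟨s, rfl⟩ := h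
  exact ⟨a :: s, by simp⟩

lemma HasCenter.length_mod_two {α : Type*} {p : List α} {c : Option α} (h : HasCenter p c) :
    p.length % 2 = c.toList.length := by
  obtain ⟨s, rfl⟩ := h
  cases c <;> simp <;> omega

lemma HasCenter.unique {α : Type*} {p : List α} {c d : Option α} (hc : HasCenter p c)
    (hd : HasCenter p d) : c = d := by
  have hlen : c.toList.length = d.toList.length := by
    rw [← hc.length_mod_two, ← hd.length_mod_two]
  obtain ⟨s, rfl⟩ := hc
  obtain ⟨t, ht⟩ := hd
  have hst : s.length = t.length := by
    have := congrArg List.length ht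
    simp only [List.length_append, List.length_reverse] at this
    omega
  have h1 := (List.append_inj ht (by simp [hst, hlen])).1
  have h2 := (List.append_inj h1 hst).2
  cases c <;> cases d <;> simp_all

lemma exists_hasCenter {α : Type*} {p : List α} (h : p.reverse = p) : ∃ c, HasCenter p c := by
  obtain ⟨m, hm⟩ : ∃ m, p.length ≤ m := ⟨_, le_rfl⟩
  induction m generalizing p with
  | zero => exact ⟨none, [], by simpa using hm⟩
  | succ m ih =>
    rcases p with _ | ⟨a, w⟩
    · exact ⟨none, [], by simp⟩
    rcases List.eq_nil_or_concat' w with rfl | ⟨x, b, rfl⟩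
    · exact ⟨some a, [], by simp⟩
    simp only [List.reverse_cons, List.reverse_append, List.reverse_nil, List.nil_append,
      List.cons_append, List.cons.injEq] at h
    obtain ⟨rfl, h⟩ := h
    obtain ⟨c, hc⟩ := ih (p := x) (by simpa using h) (by simp at hm; omega)
    exact ⟨c, hc.cons_append _⟩

/-- Palindromic factors with the same center form a chain under symmetric prolongation. -/
lemma IsSturmian.eq_of_hasCenter (hu : IsSturmian u) {p q : List (Fin 2)} {c : Option (Fin 2)}
    (hp : IsFactor u p) (hq : IsFactor u q) (hpc : HasCenter p c) (hqc : HasCenter q c)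
    (hl : p.length = q.length) : p = q := by
  obtain ⟨s, rfl⟩ := hpc
  obtain ⟨t, rfl⟩ := hqc
  have hst : s.length = t.length := by simp at hl; omega
  clear hl
  induction s generalizing t with
  | nil =>
    obtain rfl : t = [] := List.length_eq_zero_iff.1 hst.symm
    rfl
  | cons a s ih =>
    rcases t with _ | ⟨b, t⟩
    · simp at hst
    have h := ih (hp.of_infix ⟨[a], [a], by simp⟩) t (hq.of_infix ⟨[b], [b], by simp⟩)
      (by simpa using hst)
    have hpal := HasCenter.reverse_eq (p := t ++ c.toList ++ t.reverse) ⟨t, rfl⟩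
    have e1 : ∀ (d : Fin 2) (r : List (Fin 2)), d :: r ++ c.toList ++ (d :: r).reverse =
      d :: (r ++ c.toList ++ r.reverse) ++ [d] := by simp
    rw [e1] at hp hq ⊢
    rw [e1, h]
    rw [h] at hp
    rw [hu.eq_of_isFactor_cons_append_self hpal hp hq]

lemma IsSturmian.exists_hasCenter_of_length (hu : IsSturmian u) {c : Option (Fin 2)} {m : ℕ}
    (hm : m % 2 = c.toList.length) : ∃ q, IsFactor u q ∧ HasCenter q c ∧ q.length = m := by
  obtain ⟨k, rfl⟩ : ∃ k, m = c.toList.length + 2 * k := ⟨m / 2, by omega⟩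
  clear hm
  induction k with
  | zero =>
    refine ⟨c.toList, ?_, ⟨[], by simp⟩, by simp⟩
    rcases c with _ | c
    · exact isFactor_window u 0 0
    · obtain ⟨w, hw, hl⟩ := hu.exists_isRightSpecial 0
      rw [List.length_eq_zero_iff.1 hl] at hw
      exact hw.isFactor_append c
  | succ k ih =>
    obtain ⟨q, hq, hc, hl⟩ := ih
    obtain ⟨a, ha⟩ := hu.exists_isFactor_cons_append_self hq hc.reverse_eq
    exact ⟨_, ha, hc.cons_append a, by simp; omega⟩

end Reversal

/-! ### The bispecial factors containing a given factor -/

/-- The bispecial factors of `u` that contain `w`. -/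
def bispecialsContaining {α : Type*} (u : ℕ → α) (w : List α) : Set (List α) :=
  {b | IsBispecial u b ∧ w <:+: b}

section Containing

variable {α : Type*} {u : ℕ → α}

/-- Appending the only letter that can follow `w` changes no bispecial factor around `w`. -/
lemma bispecialsContaining_append {w : List α} {a : α} (hr : ¬ IsRightSpecial u w)
    (ha : IsFactor u (w ++ [a])) :
    bispecialsContaining u (w ++ [a]) = bispecialsContaining u w := by
  ext b
  refine ⟨fun ⟨hb, h⟩ => ⟨hb, List.IsInfix.trans ⟨[], [a], by simp⟩ h⟩, ?_⟩
  rintro ⟨hb, s, t, rfl⟩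
  rcases t with _ | ⟨c, t⟩
  · exact absurd (hb.2.of_suffix ⟨s, by simp⟩) hr
  · obtain rfl : a = c :=
      eq_of_not_isRightSpecial hr ha (hb.1.1.of_infix ⟨s, t, by simp⟩)
    exact ⟨hb, s, t, by simp⟩

lemma bispecialsContaining_cons {w : List α} {a : α} (hl : ¬ IsLeftSpecial u w)
    (ha : IsFactor u (a :: w)) :
    bispecialsContaining u (a :: w) = bispecialsContaining u w := by
  ext b
  refine ⟨fun ⟨hb, h⟩ => ⟨hb, List.IsInfix.trans ⟨[a], [], by simp⟩ h⟩, ?_⟩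
  rintro ⟨hb, s, t, rfl⟩
  rcases List.eq_nil_or_concat' s with rfl | ⟨s, c, rfl⟩
  · exact absurd (hb.1.of_prefix ⟨t, by simp⟩) hl
  · obtain rfl : a = c :=
      eq_of_not_isLeftSpecial hl ha (hb.1.1.of_infix ⟨s, t, by simp⟩)
    exact ⟨hb, s, t, by simp⟩

/-- The form in which shortest bispecial factors are found: only the set of bispecial factors
containing `w` matters, and a bispecial `v` is the shortest factor containing itself. -/
lemma isShortestBispecialContaining_of_eq {v w : List α} (hv : IsBispecial u v)
    (h : bispecialsContaining u w = bispecialsContaining u v) :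
    IsShortestBispecialContaining u w v := by
  change IsTheShortest (bispecialsContaining u w) v
  rw [h]
  refine ⟨⟨hv, List.infix_refl v⟩, fun b hb hne => lt_of_le_of_ne hb.2.length_le fun hl => ?_⟩
  exact hne (hb.2.eq_of_length hl).symm

lemma IsTheShortest.eq {S : Set (List α)} {v w : List α} (hv : IsTheShortest S v)
    (hw : IsTheShortest S w) : v = w := by
  by_contra h
  have h1 := hv.2 w hw.1 (Ne.symm h)
  have h2 := hw.2 v hv.1 h
  omega

lemma eq_of_bispecialsContaining_eq {v w : List α} (hv : IsBispecial u v) (hw : IsBispecial u w)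
    (h : bispecialsContaining u v = bispecialsContaining u w) : v = w :=
  IsTheShortest.eq (isShortestBispecialContaining_of_eq hv rfl)
    (isShortestBispecialContaining_of_eq hw h)

end Containing

section Existence

variable {u : ℕ → Fin 2}

/-- If all prolongations of `w` to the right were forced, `u` would go on in the same way after any
two occurrences of `w`. -/
lemma IsSturmian.exists_isRightSpecial_prefix (hu : IsSturmian u) {w : List (Fin 2)}
    (hw : IsFactor u w) : ∃ g, IsRightSpecial u g ∧ w <+: g := by
  by_contra! hno
  obtain ⟨i, hi⟩ := hw.exists_window
  obtain ⟨j, hij, hj⟩ := hu.exists_window_ge hw (i + 1)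
  have hns : ∀ t, ¬ IsRightSpecial u (window u i (w.length + t)) := by
    intro t ht
    refine hno _ ht ?_
    rw [window_add, ← hi]
    exact List.prefix_append _ _
  have key : ∀ t, window u i (w.length + t) = window u j (w.length + t) ∧
      u (i + (w.length + t)) = u (j + (w.length + t)) := by
    have letter : ∀ t, window u i (w.length + t) = window u j (w.length + t) →
        u (i + (w.length + t)) = u (j + (w.length + t)) := by
      intro t h
      apply eq_of_not_isRightSpecial (hns t)
      · rw [← window_succ]; exact isFactor_window _ _ _
      · rw [h, ← window_succ]; exact isFactor_window _ _ _
    intro t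
    induction t with
    | zero =>
      have h : window u i (w.length + 0) = window u j (w.length + 0) := hi.symm.trans hj
      exact ⟨h, letter 0 h⟩
    | succ t ih =>
      have h : window u i (w.length + (t + 1)) = window u j (w.length + (t + 1)) := by
        rw [← Nat.add_assoc, window_succ, window_succ, ih.1, ih.2]
      exact ⟨h, letter _ h⟩
  refine hu.not_eventuallyPeriodic ⟨i + w.length, j - i, by omega, fun t => ?_⟩
  have := (key t).2
  rw [show i + w.length + t + (j - i) = j + (w.length + t) by omega, Nat.add_assoc i]
  exact this.symm

/-- A right special factor stays right special when it is prolonged to the left by forced letters. -/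
lemma IsSturmian.exists_isBispecial_of_suffix (hu : IsSturmian u) {g h : List (Fin 2)}
    (hg : IsRightSpecial u g) (hh : IsLeftSpecial u h) (hgh : g <:+ h) :
    ∃ b, IsBispecial u b ∧ g <:+ b := by
  obtain ⟨s, rfl⟩ := hgh
  obtain ⟨m, hm⟩ : ∃ m, s.length ≤ m := ⟨_, le_rfl⟩
  induction m generalizing s g with
  | zero =>
    obtain rfl := List.length_eq_zero_iff.1 (Nat.le_zero.1 hm)
    exact ⟨g, ⟨hh, hg⟩, List.suffix_refl _⟩
  | succ m ih =>
    by_cases hgl : IsLeftSpecial u g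
    · exact ⟨g, ⟨hgl, hg⟩, List.suffix_refl _⟩
    rcases List.eq_nil_or_concat' s with rfl | ⟨s, a, rfl⟩
    · exact absurd hh hgl
    have ha : IsFactor u (a :: g) := hh.1.of_infix ⟨s, [], by simp⟩
    have hag : ∀ c, IsFactor u (a :: g ++ [c]) := by
      intro c
      obtain ⟨e, he⟩ := hu.exists_cons (hg.isFactor_append c)
      obtain rfl : a = e := eq_of_not_isLeftSpecial hgl ha (he.of_infix ⟨[], [c], by simp⟩)
      exact he
    obtain ⟨b, hb, hs⟩ := ih (g := a :: g) ⟨ha, 0, 1, by simp, hag 0, hag 1⟩ s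
      (by simpa using hh) (by simpa using hm)
    exact ⟨b, hb, (List.suffix_cons a g).trans hs⟩

lemma IsSturmian.nonempty_bispecialsContaining (hu : IsSturmian u) {w : List (Fin 2)}
    (hw : IsFactor u w) : (bispecialsContaining u w).Nonempty := by
  obtain ⟨g, hg, hwg⟩ := hu.exists_isRightSpecial_prefix hw
  obtain ⟨h, hh, hgh⟩ := hu.exists_isRightSpecial_prefix (hu.isFactor_reverse hg.1)
  obtain ⟨b, hb, hgb⟩ := hu.exists_isBispecial_of_suffix hg (hu.isLeftSpecial_reverse hh)
    (by simpa using List.reverse_suffix.2 hgh)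
  exact ⟨b, hb, hwg.isInfix.trans hgb.isInfix⟩

lemma IsSturmian.bispecialsContaining_cons_append_self (hu : IsSturmian u) {q : List (Fin 2)}
    (hpal : q.reverse = q) (hq : ¬ IsBispecial u q) {a : Fin 2} (ha : IsFactor u (a :: q ++ [a])) :
    bispecialsContaining u (a :: q ++ [a]) = bispecialsContaining u q := by
  have hr : ¬ IsRightSpecial u q := fun h => hq (hu.isBispecial_of_isRightSpecial hpal h)
  have hl : ¬ IsLeftSpecial u q := fun h => hq (hu.isBispecial_of_isLeftSpecial hpal h)
  rw [bispecialsContaining_append (fun h => hr (h.of_suffix (List.suffix_cons a q))) ha,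
    bispecialsContaining_cons hl (ha.of_infix ⟨[], [a], by simp⟩)]

lemma IsSturmian.exists_isBispecial_hasCenter (hu : IsSturmian u) {q : List (Fin 2)}
    {c : Option (Fin 2)} (hq : IsFactor u q) (hc : HasCenter q c) :
    ∃ b, IsBispecial u b ∧ q.length ≤ b.length ∧ HasCenter b c := by
  obtain ⟨b, hb⟩ := hu.nonempty_bispecialsContaining hq
  obtain ⟨m, hm⟩ : ∃ m, b.length ≤ q.length + m := ⟨_, Nat.le_add_left _ _⟩
  induction m generalizing q with
  | zero =>
    obtain rfl := hb.2.eq_of_length (le_antisymm hb.2.length_le hm)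
    exact ⟨q, hb.1, le_rfl, hc⟩
  | succ m ih =>
    by_cases hqb : IsBispecial u q
    · exact ⟨q, hqb, le_rfl, hc⟩
    obtain ⟨a, ha⟩ := hu.exists_isFactor_cons_append_self hq hc.reverse_eq
    have hB := hu.bispecialsContaining_cons_append_self hc.reverse_eq hqb ha
    obtain ⟨b', hb', hl, hc'⟩ := ih ha (hc.cons_append a) (hB ▸ hb) (by simp; omega)
    exact ⟨b', hb', by simp at hl; omega, hc'⟩

lemma IsSturmian.exists_isShortestBispecialWithCenter (hu : IsSturmian u) (n : ℕ)
    (c : Option (Fin 2)) : ∃ v, IsShortestBispecialWithCenter u n c v := by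
  obtain ⟨q, hq, hc, hl⟩ := hu.exists_hasCenter_of_length (c := c)
    (m := c.toList.length + 2 * n) (by cases c <;> simp)
  obtain ⟨b, hb, hbl, hbc⟩ := hu.exists_isBispecial_hasCenter hq hc
  obtain ⟨v, hv, hmin⟩ := WellFounded.has_min (measure (List.length (α := Fin 2))).wf
    {b | IsBispecial u b ∧ n ≤ b.length ∧ HasCenter b c} ⟨b, hb, by omega, hbc⟩
  refine ⟨v, hv, fun x hx hne => lt_of_le_of_ne (not_lt.1 (hmin x hx)) fun h => hne ?_⟩
  exact hu.eq_of_isRightSpecial hx.1.2 hv.1.2 h.symm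

/-- A palindrome grows symmetrically, by forced letters, into the next bispecial factor with its
center. -/
lemma IsSturmian.bispecialsContaining_eq_of_hasCenter (hu : IsSturmian u) {q v : List (Fin 2)}
    {c : Option (Fin 2)} (hq : IsFactor u q) (hqc : HasCenter q c)
    (hv : IsBispecial u v) (hvc : HasCenter v c) (hqv : q.length ≤ v.length)
    (hmin : ∀ b, IsBispecial u b → HasCenter b c → q.length ≤ b.length → v.length ≤ b.length) :
    bispecialsContaining u q = bispecialsContaining u v := by
  obtain ⟨m, hm⟩ : ∃ m, v.length ≤ q.length + m := ⟨_, Nat.le_add_left _ _⟩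
  induction m generalizing q with
  | zero => rw [hu.eq_of_hasCenter hq hv.1.1 hqc hvc (by omega)]
  | succ m ih =>
    by_cases hqb : IsBispecial u q
    · rw [hu.eq_of_hasCenter hq hv.1.1 hqc hvc (le_antisymm hqv (hmin q hqb hqc le_rfl))]
    have hne : q.length ≠ v.length := by
      intro h
      rw [hu.eq_of_hasCenter hq hv.1.1 hqc hvc h] at hqb
      exact hqb hv
    have hpar : q.length % 2 = v.length % 2 := by
      rw [hqc.length_mod_two, hvc.length_mod_two]
    obtain ⟨a, ha⟩ := hu.exists_isFactor_cons_append_self hq hqc.reverse_eq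
    rw [← hu.bispecialsContaining_cons_append_self hqc.reverse_eq hqb ha]
    refine ih ha (hqc.cons_append a) (by simp; omega) (fun b hb hbc hl => hmin b hb hbc ?_)
      (by simp; omega)
    simp at hl
    omega

/-- A center not realized by a bispecial factor of length `m` is realized in length `m + 1`: start
from the palindrome with that center whose length is `m` or `m + 1`, whichever has the right
parity. -/
lemma IsSturmian.exists_bispecialsContaining_eq (hu : IsSturmian u) {m : ℕ} {v : List (Fin 2)}
    {c : Option (Fin 2)} (hv : IsShortestBispecialWithCenter u (m + 1) c v)
    (hno : ∀ b, IsBispecial u b → b.length = m → ¬ HasCenter b c) :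
    ∃ w, IsFactor u w ∧ w.length = m + 1 ∧
      bispecialsContaining u w = bispecialsContaining u v := by
  obtain ⟨⟨hvb, hvl, hvc⟩, hmin⟩ := hv
  have hmin' : ∀ b, IsBispecial u b → HasCenter b c → m ≤ b.length → v.length ≤ b.length := by
    intro b hb hbc hl
    by_cases hbv : b = v
    · rw [hbv]
    · have : b.length ≠ m := fun h => hno b hb h hbc
      exact (hmin b ⟨hb, by omega, hbc⟩ hbv).le
  by_cases hpar : (m + 1) % 2 = c.toList.length
  · obtain ⟨q, hq, hqc, hl⟩ := hu.exists_hasCenter_of_length hpar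
    exact ⟨q, hq, hl, hu.bispecialsContaining_eq_of_hasCenter hq hqc hvb hvc (by omega)
      fun b hb hbc h => hmin' b hb hbc (by omega)⟩
  · obtain ⟨q, hq, hqc, hl⟩ := hu.exists_hasCenter_of_length (c := c) (m := m)
      (by cases c <;> simp at hpar ⊢ <;> omega)
    have hqb : ¬ IsBispecial u q := fun h => hno q h hl hqc
    have hql : ¬ IsLeftSpecial u q := fun h =>
      hqb (hu.isBispecial_of_isLeftSpecial hqc.reverse_eq h)
    obtain ⟨a, ha⟩ := hu.exists_cons hq
    refine ⟨a :: q, ha, by simp [hl], ?_⟩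
    rw [bispecialsContaining_cons hql ha]
    exact hu.bispecialsContaining_eq_of_hasCenter hq hqc hvb hvc (by omega)
      fun b hb hbc h => hmin' b hb hbc (by omega)

/-! ### At most three classes of factors of a given length -/

/-- Sliding a block `d :: t` one place to the right changes nothing unless `t` is special, so every
factor is equivalent to one of the form `d :: l` or `d :: r` with `l`, `r` the special factors. -/
lemma IsSturmian.bispecialsContaining_eq_cons_special (hu : IsSturmian u) {l r w : List (Fin 2)}
    (hl : IsLeftSpecial u l) (hr : IsRightSpecial u r) (hlr : l.length = r.length)
    (hw : IsFactor u w) (hwl : w.length = r.length + 1) :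
    ∃ d, bispecialsContaining u w = bispecialsContaining u (d :: l) ∨
      IsFactor u (d :: r) ∧ bispecialsContaining u w = bispecialsContaining u (d :: r) := by
  obtain ⟨i, hi⟩ := hw.exists_window
  obtain ⟨j, hij, hj⟩ := hu.exists_window_ge hr.1 (i + 1)
  obtain ⟨k, rfl⟩ := Nat.exists_eq_add_of_le hij
  rw [hwl] at hi
  subst hi
  clear hw hwl hij
  induction k generalizing i with
  | zero =>
    rw [window_succ', show i + 1 = i + 1 + 0 by omega, ← hj]
    refine ⟨u i, Or.inr ⟨?_, rfl⟩⟩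
    conv => enter [2, 2]; rw [hj]
    exact window_succ' u i _ ▸ isFactor_window _ _ _
  | succ k ih =>
    have hf : IsFactor u (u i :: window u (i + 1) r.length) :=
      window_succ' u i _ ▸ isFactor_window _ _ _
    have hf' : IsFactor u (window u (i + 1) r.length ++ [u (i + 1 + r.length)]) :=
      window_succ u (i + 1) _ ▸ isFactor_window _ _ _
    by_cases hL : IsLeftSpecial u (window u (i + 1) r.length)
    · refine ⟨u i, Or.inl ?_⟩
      rw [window_succ', hu.eq_of_isLeftSpecial hL hl (by simp [hlr])]
    by_cases hR : IsRightSpecial u (window u (i + 1) r.length)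
    · rw [hu.eq_of_isRightSpecial hR hr (by simp)] at hf
      refine ⟨u i, Or.inr ⟨hf, ?_⟩⟩
      rw [window_succ', hu.eq_of_isRightSpecial hR hr (by simp)]
    · rw [window_succ', bispecialsContaining_cons hL hf, ← bispecialsContaining_append hR hf',
        ← window_succ]
      exact ih (i + 1) (by rw [show i + 1 + 1 + k = i + 1 + (k + 1) by omega]; exact hj)

end Existence

/-! ### The three shortest bispecial factors -/

theorem theorem46 (u : ℕ → Fin 2) (hu : IsSturmian u) (n : ℕ) (hn : 1 ≤ n) :
    ∃ P : Option (Fin 2) → List (Fin 2),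
      -- `P none`, `P (some 0)`, `P (some 1)` are the three bispecial factors of the theorem
      (∀ c : Option (Fin 2), IsShortestBispecialWithCenter u n c (P c)) ∧
      -- every factor of length `n` has a shortest bispecial factor containing it,
      -- and that is one of the three
      (∀ w : List (Fin 2), IsFactor u w → w.length = n →
        ∃ v : List (Fin 2), IsShortestBispecialContaining u w v ∧
          (v = P none ∨ v = P (some 0) ∨ v = P (some 1))) ∧
      -- no bispecial factor of length `n - 1`: all three occur
      ((¬ ∃ v : List (Fin 2), IsBispecial u v ∧ v.length + 1 = n) →
        ∀ i : Option (Fin 2), ∃ w : List (Fin 2), IsFactor u w ∧ w.length = n ∧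
          IsShortestBispecialContaining u w (P i)) ∧
      -- a bispecial factor `v` of length `n - 1`: it is a palindrome, and exactly the two
      -- with a center other than that of `v` occur
      (∀ v : List (Fin 2), IsBispecial u v → v.length + 1 = n →
        ∃ i : Option (Fin 2), HasCenter v i ∧
          (∀ j : Option (Fin 2), j ≠ i → ∃ w : List (Fin 2), IsFactor u w ∧ w.length = n ∧
            IsShortestBispecialContaining u w (P j)) ∧
          (∀ w : List (Fin 2), IsFactor u w → w.length = n →
            ¬ IsShortestBispecialContaining u w (P i))) := by
  obtain ⟨m, rfl⟩ := Nat.exists_eq_add_of_le' hn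
  choose P hP using hu.exists_isShortestBispecialWithCenter (m + 1)
  have hPb : ∀ c, IsBispecial u (P c) := fun c => (hP c).1.1
  have hinj : ∀ c d, c ≠ d →
      bispecialsContaining u (P c) ≠ bispecialsContaining u (P d) := by
    intro c d hcd h
    have := eq_of_bispecialsContaining_eq (hPb c) (hPb d) h
    exact hcd ((hP c).1.2.2.unique (this ▸ (hP d).1.2.2))
  obtain ⟨r, hr, hrm⟩ := hu.exists_isRightSpecial m
  have hl := hu.isLeftSpecial_reverse hr
  have hclass := fun w hw hwl => hu.bispecialsContaining_eq_cons_special (w := w) hl hr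
    (by simp) hw (by omega)
  -- if `v` is bispecial of length `m`, the classes of `0v` and `1v` are the only ones
  have hbis : ∀ v i, IsBispecial u v → v.length = m → HasCenter v i →
      ∀ w, IsFactor u w → w.length = m + 1 →
      ∃ j, j ≠ i ∧ bispecialsContaining u w = bispecialsContaining u (P j) := by
    intro v i hv hvm hvi
    obtain rfl : v = r := hu.eq_of_isRightSpecial hv.2 hr (by omega)
    have h2 : ∀ w, IsFactor u w → w.length = m + 1 →
        bispecialsContaining u w = bispecialsContaining u (0 :: v) ∨
        bispecialsContaining u w = bispecialsContaining u (1 :: v) := by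
      intro w hw hwl
      obtain ⟨d, hd⟩ := hclass w hw (by omega)
      rw [hu.reverse_eq_of_isBispecial hv] at hd
      obtain rfl | rfl : d = 0 ∨ d = 1 := by omega
      · exact Or.inl (hd.elim id And.right)
      · exact Or.inr (hd.elim id And.right)
    obtain ⟨j, k, hj, hk, hjk⟩ : ∃ j k : Option (Fin 2), j ≠ i ∧ k ≠ i ∧ j ≠ k := by
      clear hvi
      revert i
      decide
    have hex : ∀ j, j ≠ i → ∃ w, IsFactor u w ∧ w.length = m + 1 ∧
        bispecialsContaining u w = bispecialsContaining u (P j) := by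
      intro j hj
      refine hu.exists_bispecialsContaining_eq (hP j) fun b hb hbl hbc => hj ?_
      obtain rfl : b = v := hu.eq_of_isRightSpecial hb.2 hv.2 (by omega)
      exact hbc.unique hvi
    intro w hw hwl
    obtain ⟨x, hx, hxl, hxj⟩ := hex j hj
    obtain ⟨y, hy, hyl, hyk⟩ := hex k hk
    have hx2 := h2 x hx hxl
    have hy2 := h2 y hy hyl
    have hw2 := h2 w hw hwl
    have hne := hinj j k hjk
    rw [hxj] at hx2
    rw [hyk] at hy2
    by_cases h : bispecialsContaining u w = bispecialsContaining u (P j)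
    · exact ⟨j, hj, h⟩
    · exact ⟨k, hk, by grind⟩
  have hnobis : (¬ ∃ v : List (Fin 2), IsBispecial u v ∧ v.length + 1 = m + 1) →
      ∀ i, ∃ w, IsFactor u w ∧ w.length = m + 1 ∧
        bispecialsContaining u w = bispecialsContaining u (P i) := fun hno i =>
    hu.exists_bispecialsContaining_eq (hP i) fun b hb hbl _ => hno ⟨b, hb, by omega⟩
  have hall : ∀ w, IsFactor u w → w.length = m + 1 →
      ∃ j, bispecialsContaining u w = bispecialsContaining u (P j) := by
    intro w hw hwl
    by_cases hno : ∃ v : List (Fin 2), IsBispecial u v ∧ v.length + 1 = m + 1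
    · obtain ⟨v, hv, hvm⟩ := hno
      obtain ⟨i, hi⟩ := exists_hasCenter (hu.reverse_eq_of_isBispecial hv)
      obtain ⟨j, _, hj⟩ := hbis v i hv (by omega) hi w hw hwl
      exact ⟨j, hj⟩
    · have hrl : ¬ IsLeftSpecial u r := fun h => hno ⟨r, ⟨h, hr⟩, by omega⟩
      obtain ⟨e, he⟩ := hu.exists_cons hr.1
      have h3 : ∀ w, IsFactor u w → w.length = m + 1 →
          bispecialsContaining u w = bispecialsContaining u (0 :: r.reverse) ∨
          bispecialsContaining u w = bispecialsContaining u (1 :: r.reverse) ∨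
          bispecialsContaining u w = bispecialsContaining u (e :: r) := by
        intro w hw hwl
        obtain ⟨d, hd | ⟨hdr, hd⟩⟩ := hclass w hw (by omega)
        · obtain rfl | rfl : d = 0 ∨ d = 1 := by omega
          · exact Or.inl hd
          · exact Or.inr (Or.inl hd)
        · rw [eq_of_not_isLeftSpecial hrl hdr he] at hd
          exact Or.inr (Or.inr hd)
      -- the three distinct classes of the `P i` exhaust the three possible ones
      have hP3 : ∀ i,
          bispecialsContaining u (P i) = bispecialsContaining u (0 :: r.reverse) ∨
          bispecialsContaining u (P i) = bispecialsContaining u (1 :: r.reverse) ∨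
          bispecialsContaining u (P i) = bispecialsContaining u (e :: r) := by
        intro i
        obtain ⟨x, hx, hxl, hxi⟩ := hnobis hno i
        have := h3 x hx hxl
        rwa [hxi] at this
      have hp := hP3 none
      have hq := hP3 (some 0)
      have ht := hP3 (some 1)
      have hw3 := h3 w hw hwl
      have n1 := hinj none (some 0) (by simp)
      have n2 := hinj none (some 1) (by simp)
      have n3 := hinj (some 0) (some 1) (by simp)
      by_contra! hcon
      have c1 := hcon none
      have c2 := hcon (some 0)
      have c3 := hcon (some 1)
      clear hcon h3 hP3 hnobis hbis hinj
      generalize bispecialsContaining u (P none) = p at *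
      generalize bispecialsContaining u (P (some 0)) = q at *
      generalize bispecialsContaining u (P (some 1)) = t at *
      grind
  refine ⟨P, hP, ?_, ?_, ?_⟩
  · intro w hw hwl
    obtain ⟨j, hj⟩ := hall w hw hwl
    refine ⟨P j, isShortestBispecialContaining_of_eq (hPb j) hj, ?_⟩
    rcases j with _ | j
    · exact Or.inl rfl
    · obtain rfl | rfl : j = 0 ∨ j = 1 := by omega
      · exact Or.inr (Or.inl rfl)
      · exact Or.inr (Or.inr rfl)
  · intro hno i
    obtain ⟨w, hw, hwl, hwi⟩ := hnobis hno i
    exact ⟨w, hw, hwl, isShortestBispecialContaining_of_eq (hPb i) hwi⟩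
  · intro v hv hvm
    obtain ⟨i, hi⟩ := exists_hasCenter (hu.reverse_eq_of_isBispecial hv)
    refine ⟨i, hi, fun j hj => ?_, fun w hw hwl hwi => ?_⟩
    · obtain ⟨w, hw, hwl, hwj⟩ := hu.exists_bispecialsContaining_eq (hP j)
        fun b hb hbl hbc => hj (by
          obtain rfl : b = v := hu.eq_of_isRightSpecial hb.2 hv.2 (by omega)
          exact hbc.unique hi)
      exact ⟨w, hw, hwl, isShortestBispecialContaining_of_eq (hPb j) hwj⟩
    · obtain ⟨j, hj, hwj⟩ := hbis v i hv (by omega) hi w hw hwl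
      have := IsTheShortest.eq hwi (isShortestBispecialContaining_of_eq (hPb j) hwj)
      exact hinj i j (Ne.symm hj) (by rw [this])
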